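/- Let $b,c\in C[0,1]$ and $\lambda,a_1,a_2,a_3,a_4\in C([0,1]^2)$ be non-negative, let $\phi\in C[0,1]$ with $0\le\phi\le 1$, and let $T>0$. Let $\rho:[0,\infty)\to C[0,1]$ be the solution, with respect to the norm $\|\cdot\|_\infty$, of $\rho(0,\cdot)=\phi$ and \begin{align*} \tfrac{d}{dt}\rho(t,u)={}&b(u)(c(u)-1)\rho(t,u)+\rho(t,u)\int_0^1\lambda(v,u)(a_4(v,u)-1)\,dv+\rho(t,u)\int_0^1\lambda(u,v)(a_1(u,v)-1)\,dv\\ &+\int_0^1\lambda(u,v)a_2(u,v)\rho(t,v)\,dv+\int_0^1\lambda(v,u)a_3(v,u)\rho(t,v)\,dv . \end{align*} For $f\in C[0,1]$ put \begin{align*} P_2f(u)={}&(c(u)^2-1)b(u)f(u)+f(u)\int_0^1\lambda(u,v)(a_1(u,v)^2-1)\,dv+\int_0^1\lambda(v,u)a_2(v,u)^2f(v)\,dv\\ &+\int_0^1\lambda(u,v)a_3(u,v)^2f(v)\,dv+f(u)\int_0^1\lambda(v,u)(a_4(v,u)^2-1)\,dv,\\ l_{1,t}(f)={}&2\int_0^1\!\!\int_0^1\rho(t,u)\rho(t,v)a_1(u,v)a_2(u,v)\lambda(u,v)f(u)\,du\,dv\\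 &+2\int_0^1\!\!\int_0^1\lambda(v,u)a_3(v,u)a_4(v,u)\rho(t,u)\rho(t,v)f(u)\,du\,dv . \end{align*} Let $(\theta_t)_{0\le t\le T}$ be the solution, in the dual $(C[0,1])'$ with its norm, of $\frac{d}{dt}\theta_t=P_2^*\theta_t+l_{1,t}$ for $0\le t\le T$, $\theta_0(du)=\phi(u)\,du$, where $(P_2^*\nu)(f)=\nu(P_2f)$, and let $\vartheta\in C([0,T]\times[0,1])$ be its density: $\theta_t(du)=\vartheta(t,u)\,du$ for $0\le t\le T$. Define \begin{align*} K_1(s,u)={}&\vartheta(s,u)b(u)(c(u)-1)^2+\vartheta(s,u)\int_0^1\lambda(u,v)(a_1(u,v)-1)^2dv+\int_0^1\vartheta(s,v)\lambda(u,v)a_2(u,v)^2dv\\ &+\int_0^1\lambda(v,u)a_3(v,u)^2\vartheta(s,v)\,dv+\vartheta(s,u)\int_0^1\lambda(v,u)(a_4(v,u)-1)^2dv\\ &+2\rho(s,u)\int_0^1\lambda(u,v)(a_1(u,v)-1)a_2(u,v)\rho(s,v)\,dv\\ &+2\rho(s,u)\int_0^1\lambda(v,u)a_3(v,u)(a_4(v,u)-1)\rho(s,v)\,dv,\\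 K_2(s,u,v)={}&2\lambda(u,v)(a_1(u,v)-1)a_3(u,v)\vartheta(s,u)+2\lambda(u,v)a_2(u,v)(a_4(u,v)-1)\vartheta(s,v)\\ &+2\lambda(u,v)(a_1(u,v)-1)(a_4(u,v)-1)\rho(s,u)\rho(s,v)+2\lambda(u,v)a_2(u,v)a_3(u,v)\rho(s,u)\rho(s,v), \end{align*} and, for $f,g\in C[0,1]$ and $0\le s\le T$, \[ [f,f]_s=\int_0^1K_1(s,u)f(u)^2\,du+\int_0^1\!\!\int_0^1K_2(s,u,v)f(u)f(v)\,du\,dv,\qquad [f,g]_s=\frac{[f+g,f+g]_s-[f-g,f-g]_s}{4} \] (for $g=f$ the two definitions agree). Then such $\rho,\theta,\vartheta$ exist, and for any such $\rho,\theta,\vartheta$ and every $0\le s\le T$, $[\cdot,\cdot]_s$ is a non-negative definite symmetric bilinear form on $C[0,1]$: for all $f_1,f_2,g\in C[0,1]$ and $c_1,c_2\in\mathbb R$, \[ [f_1,f_1]_s\ge 0,\qquad [f_1,f_2]_s=[f_2,f_1]_s,\qquad [c_1f_1+c_2f_2,g]_s=c_1[f_1,g]_s+c_2[f_2,g]_s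 . \] -/

import Mathlib

open MeasureTheory unitInterval

noncomputable section

/-- The coefficients of the `N`-urn linear system: the rate functions `b`, `lam`, the
multiplicative coefficients `c`, `a1`, `a2`, `a3`, `a4`, and the initial profile `phi`,
all continuous on `[0,1]` or `[0,1]²`. -/
structure UrnSystem where
  b : C(I, ℝ)
  c : C(I, ℝ)
  lam : C(I × I, ℝ)
  a1 : C(I × I, ℝ)
  a2 : C(I × I, ℝ)
  a3 : C(I × I, ℝ)
  a4 : C(I × I, ℝ)
  phi : C(I, ℝ)

namespace UrnSystem

/-- The standing assumptions on the coefficients: all rates and coefficients are non-negative and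
the initial profile takes its values (probabilities) in `[0,1]`. -/
structure Admissible (S : UrnSystem) : Prop where
  b_nonneg : ∀ u, 0 ≤ S.b u
  c_nonneg : ∀ u, 0 ≤ S.c u
  lam_nonneg : ∀ p, 0 ≤ S.lam p
  a1_nonneg : ∀ p, 0 ≤ S.a1 p
  a2_nonneg : ∀ p, 0 ≤ S.a2 p
  a3_nonneg : ∀ p, 0 ≤ S.a3 p
  a4_nonneg : ∀ p, 0 ≤ S.a4 p
  phi_mem : ∀ u, 0 ≤ S.phi u ∧ S.phi u ≤ 1

/-- A continuous function on `[0,1]` (a compact space of total mass one) is integrable. -/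
theorem integrable_of_continuous {g : I → ℝ} (hg : Continuous g) : Integrable g :=
  integrableOn_univ.mp (hg.continuousOn.integrableOn_compact isCompact_univ)

/-- The integral operator `f ↦ (u ↦ ∫ k(u,v) f(v) dv)` on `C[0,1]`. -/
def kernelOp (k : C(I × I, ℝ)) : C(I, ℝ) →L[ℝ] C(I, ℝ) :=
  LinearMap.mkContinuous
    { toFun := fun f =>
        ⟨fun u => ∫ v : I, k (u, v) * f v, by
          have h : Continuous (Function.uncurry fun u v : I => k (u, v) * f v) := by
            simp only [Function.uncurry_def]
            fun_prop
          simpa using continuous_parametric_integral_of_continuous (μ := (volume : Measure I))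
            h isCompact_univ⟩
      map_add' := fun f g => by
        ext u
        simp only [ContinuousMap.coe_mk, ContinuousMap.add_apply, mul_add]
        exact integral_add (integrable_of_continuous (by fun_prop))
          (integrable_of_continuous (by fun_prop))
      map_smul' := fun r f => by
        ext u
        simp only [ContinuousMap.coe_mk, ContinuousMap.smul_apply, smul_eq_mul, RingHom.id_apply,
          ← integral_const_mul]
        exact integral_congr_ae (Filter.Eventually.of_forall fun v => by ring) }
    ‖k‖ (fun f => by
      rw [ContinuousMap.norm_le _ (by positivity)]
      intro u
      have h := norm_integral_le_of_norm_le_const (μ := (volume : Measure I))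
        (f := fun v : I => k (u, v) * f v) (C := ‖k‖ * ‖f‖)
        (Filter.Eventually.of_forall fun v => by
          rw [norm_mul]
          exact mul_le_mul (k.norm_coe_le_norm _) (f.norm_coe_le_norm _) (norm_nonneg _)
            (norm_nonneg _))
      simpa using h)

@[simp] theorem kernelOp_apply (k : C(I × I, ℝ)) (f : C(I, ℝ)) (u : I) :
    kernelOp k f u = ∫ v : I, k (u, v) * f v := rfl

/-- The function `u ↦ ∫ k(u,v) dv`. -/
def rowIntegral (k : C(I × I, ℝ)) : C(I, ℝ) := kernelOp k 1

@[simp] theorem rowIntegral_apply (k : C(I × I, ℝ)) (u : I) :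
    rowIntegral k u = ∫ v : I, k (u, v) := by
  simp [rowIntegral]

/-- The transposed kernel `(u,v) ↦ k(v,u)`. -/
def transpose (k : C(I × I, ℝ)) : C(I × I, ℝ) := k.comp ⟨Prod.swap, continuous_swap⟩

@[simp] theorem transpose_apply (k : C(I × I, ℝ)) (u v : I) :
    transpose k (u, v) = k (v, u) := rfl

/-- Multiplication by `g` as an operator on `C[0,1]`. -/
def mulOp (g : C(I, ℝ)) : C(I, ℝ) →L[ℝ] C(I, ℝ) := ContinuousLinearMap.mul ℝ C(I, ℝ) g

@[simp] theorem mulOp_apply (g f : C(I, ℝ)) (u : I) : mulOp g f u = g u * f u := rfl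

/-- The measure `g(u) du`, as an element of the dual of `C[0,1]`. -/
def densityFunctional (g : C(I, ℝ)) : StrongDual ℝ C(I, ℝ) :=
  LinearMap.mkContinuous
    { toFun := fun f => ∫ u : I, g u * f u
      map_add' := fun f h => by
        simp only [ContinuousMap.add_apply, mul_add]
        exact integral_add (integrable_of_continuous (by fun_prop))
          (integrable_of_continuous (by fun_prop))
      map_smul' := fun r f => by
        simp only [ContinuousMap.smul_apply, smul_eq_mul, RingHom.id_apply,
          ← integral_const_mul]
        exact integral_congr_ae (Filter.Eventually.of_forall fun v => by ring) }
    ‖g‖ (fun f => by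
      have h := norm_integral_le_of_norm_le_const (μ := (volume : Measure I))
        (f := fun v : I => g v * f v) (C := ‖g‖ * ‖f‖)
        (Filter.Eventually.of_forall fun v => by
          rw [norm_mul]
          exact mul_le_mul (g.norm_coe_le_norm _) (f.norm_coe_le_norm _) (norm_nonneg _)
            (norm_nonneg _))
      simpa using h)

@[simp] theorem densityFunctional_apply (g f : C(I, ℝ)) :
    densityFunctional g f = ∫ u : I, g u * f u := rfl

variable (S : UrnSystem)

/-- The right-hand side of the equation of the hydrodynamic density; see `hydroOp_apply`. -/
def hydroOp : C(I, ℝ) →L[ℝ] C(I, ℝ) :=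
  mulOp (S.b * (S.c - 1))
    + mulOp (rowIntegral (transpose (S.lam * (S.a4 - 1))))
    + mulOp (rowIntegral (S.lam * (S.a1 - 1)))
    + kernelOp (S.lam * S.a2)
    + kernelOp (transpose (S.lam * S.a3))

theorem hydroOp_apply (r : C(I, ℝ)) (u : I) :
    S.hydroOp r u =
      S.b u * (S.c u - 1) * r u
        + r u * (∫ v : I, S.lam (v, u) * (S.a4 (v, u) - 1))
        + r u * (∫ v : I, S.lam (u, v) * (S.a1 (u, v) - 1))
        + (∫ v : I, S.lam (u, v) * S.a2 (u, v) * r v)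
        + ∫ v : I, S.lam (v, u) * S.a3 (v, u) * r v := by
  simp [hydroOp, mul_comm (r u)]

/-- `ρ` solves the `C[0,1]`-valued equation `dρ/dt = hydroOp ρ`, `ρ(0) = φ`, for `t ≥ 0`, the
derivative being taken in the supremum norm (one-sided at `t = 0`). -/
def IsHydrodynamicDensity (ρ : ℝ → C(I, ℝ)) : Prop :=
  ρ 0 = S.phi ∧
    ∀ t : ℝ, 0 ≤ t → HasDerivWithinAt ρ (S.hydroOp (ρ t)) (Set.Ici 0) t

/-- `P₃ f(u) = (c(u)² - 1) b(u) f(u)`. -/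
def P3 : C(I, ℝ) →L[ℝ] C(I, ℝ) := mulOp ((S.c ^ 2 - 1) * S.b)

/-- `P₄ f(u) = f(u) ∫ λ(u,v) (a₁(u,v)² - 1) dv`. -/
def P4 : C(I, ℝ) →L[ℝ] C(I, ℝ) := mulOp (rowIntegral (S.lam * (S.a1 ^ 2 - 1)))

/-- `P₅ f(u) = ∫ λ(v,u) a₂(v,u)² f(v) dv`. -/
def P5 : C(I, ℝ) →L[ℝ] C(I, ℝ) := kernelOp (transpose (S.lam * S.a2 ^ 2))

/-- `P₆ f(u) = ∫ λ(u,v) a₃(u,v)² f(v) dv`. -/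
def P6 : C(I, ℝ) →L[ℝ] C(I, ℝ) := kernelOp (S.lam * S.a3 ^ 2)

/-- `P₇ f(u) = f(u) ∫ λ(v,u) (a₄(v,u)² - 1) dv`. -/
def P7 : C(I, ℝ) →L[ℝ] C(I, ℝ) := mulOp (rowIntegral (transpose (S.lam * (S.a4 ^ 2 - 1))))

/-- `P₂ = P₃ + P₄ + P₅ + P₆ + P₇`. -/
def P2 : C(I, ℝ) →L[ℝ] C(I, ℝ) := S.P3 + S.P4 + S.P5 + S.P6 + S.P7

theorem P2_apply (f : C(I, ℝ)) (u : I) :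
    S.P2 f u =
      (S.c u ^ 2 - 1) * S.b u * f u
        + f u * (∫ v : I, S.lam (u, v) * (S.a1 (u, v) ^ 2 - 1))
        + (∫ v : I, S.lam (v, u) * S.a2 (v, u) ^ 2 * f v)
        + (∫ v : I, S.lam (u, v) * S.a3 (u, v) ^ 2 * f v)
        + f u * ∫ v : I, S.lam (v, u) * (S.a4 (v, u) ^ 2 - 1) := by
  simp [P2, P3, P4, P5, P6, P7, mul_comm (f u)]

/-- The source functional `l₁`, for a given density `r = ρ(t,·)`; see `l1_apply`. -/
def l1 (r : C(I, ℝ)) : StrongDual ℝ C(I, ℝ) :=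
  (2 : ℝ) • densityFunctional (r * kernelOp (S.lam * S.a1 * S.a2) r)
    + (2 : ℝ) • densityFunctional (r * kernelOp (transpose (S.lam * S.a3 * S.a4)) r)

theorem l1_apply (r f : C(I, ℝ)) :
    S.l1 r f =
      2 * (∫ u : I, ∫ v : I, r u * r v * S.a1 (u, v) * S.a2 (u, v) * S.lam (u, v) * f u)
        + 2 * ∫ u : I, ∫ v : I,
            S.lam (v, u) * S.a3 (v, u) * S.a4 (v, u) * r u * r v * f u := by
  simp only [l1, add_apply, smul_apply,
    densityFunctional_apply, ContinuousMap.mul_apply, kernelOp_apply, transpose_apply, smul_eq_mul]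
  congr 2
  · refine integral_congr_ae (Filter.Eventually.of_forall fun u => ?_)
    simp only [← integral_const_mul, ← integral_mul_const]
    exact integral_congr_ae (Filter.Eventually.of_forall fun v => by ring)
  · refine integral_congr_ae (Filter.Eventually.of_forall fun u => ?_)
    simp only [← integral_const_mul, ← integral_mul_const]
    exact integral_congr_ae (Filter.Eventually.of_forall fun v => by ring)

/-- `θ` solves the equation `dθ_t/dt = P₂* θ_t + l_{1,t}`, `θ_0(du) = φ(u) du`, on `[0,T]` in the
dual of `C[0,1]` with its norm (derivatives are one-sided at the endpoints). Here
`(P₂* ν)(f) = ν(P₂ f)`. -/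
def IsSecondMomentSolution (T : ℝ) (ρ : ℝ → C(I, ℝ)) (θ : ℝ → StrongDual ℝ C(I, ℝ)) : Prop :=
  θ 0 = densityFunctional S.phi ∧
    ∀ t ∈ Set.Icc (0 : ℝ) T,
      HasDerivWithinAt θ ((θ t).comp S.P2 + S.l1 (ρ t)) (Set.Icc 0 T) t

/-- `θ_t(du) = ϑ(t,u) du` for all `t ∈ [0,T]`, with `ϑ ∈ C([0,T] × [0,1])`. -/
def IsDensityOf {T : ℝ} (ϑ : C(Set.Icc (0 : ℝ) T × I, ℝ)) (θ : ℝ → StrongDual ℝ C(I, ℝ)) : Prop :=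
  ∀ (t : Set.Icc (0 : ℝ) T) (f : C(I, ℝ)), θ t f = ∫ u : I, ϑ (t, u) * f u

section form

variable {T : ℝ} (ρ : ℝ → C(I, ℝ)) (ϑ : C(Set.Icc (0 : ℝ) T × I, ℝ)) (s : Set.Icc (0 : ℝ) T)

/-- The function `K₁(s,u)`. -/
def K1 (u : I) : ℝ :=
  ϑ (s, u) * S.b u * (S.c u - 1) ^ 2
    + ϑ (s, u) * (∫ v : I, S.lam (u, v) * (S.a1 (u, v) - 1) ^ 2)
    + (∫ v : I, ϑ (s, v) * S.lam (u, v) * S.a2 (u, v) ^ 2)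
    + (∫ v : I, S.lam (v, u) * S.a3 (v, u) ^ 2 * ϑ (s, v))
    + (∫ v : I, S.lam (v, u) * (S.a4 (v, u) - 1) ^ 2) * ϑ (s, u)
    + 2 * (∫ v : I, S.lam (u, v) * (S.a1 (u, v) - 1) * S.a2 (u, v) * ρ s v) * ρ s u
    + 2 * (∫ v : I, S.lam (v, u) * S.a3 (v, u) * (S.a4 (v, u) - 1) * ρ s v) * ρ s u

/-- The function `K₂(s,u,v)`. -/
def K2 (u v : I) : ℝ :=
  2 * S.lam (u, v) * (S.a1 (u, v) - 1) * S.a3 (u, v) * ϑ (s, u)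
    + 2 * S.lam (u, v) * S.a2 (u, v) * (S.a4 (u, v) - 1) * ϑ (s, v)
    + 2 * S.lam (u, v) * (S.a1 (u, v) - 1) * (S.a4 (u, v) - 1) * ρ s u * ρ s v
    + 2 * S.lam (u, v) * S.a2 (u, v) * S.a3 (u, v) * ρ s u * ρ s v

/-- The quadratic form `f ↦ [f,f]_s`. -/
def quadForm (f : C(I, ℝ)) : ℝ :=
  (∫ u : I, S.K1 ρ ϑ s u * f u ^ 2)
    + ∫ u : I, ∫ v : I, S.K2 ρ ϑ s u v * f u * f v

/-- The polarized form `[f,g]_s`. -/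
def bracket (f g : C(I, ℝ)) : ℝ :=
  (S.quadForm ρ ϑ s (f + g) - S.quadForm ρ ϑ s (f - g)) / 4

end form

end UrnSystem

end

/-! The number `[f,f]_s` is the limiting mean square jump rate of the field `∑ f(u) X_u`. Jumps of
a single urn contribute `∫ ϑ b (c - 1)² f² ≥ 0`. An interaction of the urns `u` and `v`, at rate
`λ(u,v)`, changes the field by `A X_u + B X_v` with `A = (a₁ - 1) f(u) + a₃ f(v)` and
`B = a₂ f(u) + (a₄ - 1) f(v)`. In the limit `E[X_u²] = ϑ(u)` and
`E[X_u X_v] = ρ(u) ρ(v)`, so the mean square of this jump is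
`(A ρ(u) + B ρ(v))² + A² (ϑ - ρ²)(u) + B² (ϑ - ρ²)(v)`,
and positivity reduces to `ρ² ≤ ϑ`. The difference `ϑ - ρ²` starts from `φ - φ² ≥ 0` and solves the
linear equation of `ϑ` with a source of the form `K₁`, in which `ϑ` is replaced by `ρ²`. That source
is non-negative by the same computation, and the generator is monotone up to a multiple of the
identity, so `ϑ - ρ²` stays non-negative. -/

/-! ### Linear differential equations and positive semigroups -/

section LinearODE

open NormedSpace Set

variable {E : Type*} [NormedAddCommGroup E] [NormedSpace ℝ E]

/-- The solution of `x' = A x + h`, `x 0 = x₀`, given by the variation of constants formula. -/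
noncomputable def duhamel (A : E →L[ℝ] E) (h : ℝ → E) (x₀ : E) (t : ℝ) : E :=
  exp (t • A) (x₀ + ∫ s in (0 : ℝ)..t, exp (-s • A) (h s))

@[simp] theorem duhamel_zero (A : E →L[ℝ] E) (h : ℝ → E) (x₀ : E) : duhamel A h x₀ 0 = x₀ := by
  simp [duhamel]

theorem hasDerivWithinAt_clm_comp {F : Type*} [NormedAddCommGroup F] [NormedSpace ℝ F]
    (B : E →L[ℝ] F) {x : ℝ → E} {x' : E} {s : Set ℝ} {t : ℝ} (hx : HasDerivWithinAt x x' s t) :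
    HasDerivWithinAt (fun t => B (x t)) (B x') s t :=
  B.hasFDerivAt.comp_hasDerivWithinAt t hx

variable [CompleteSpace E] {A : E →L[ℝ] E} {h : ℝ → E} {x₀ : E} {T t : ℝ}

theorem exp_add_of_commute_clm {A B : E →L[ℝ] E} (hAB : Commute A B) :
    exp (A + B) = exp A * exp B := by
  let : NormedAlgebra ℚ (E →L[ℝ] E) := NormedAlgebra.restrictScalars ℚ ℝ _
  exact exp_add_of_commute hAB

theorem continuous_exp_smul (A : E →L[ℝ] E) : Continuous fun t : ℝ => exp (t • A) :=
  continuous_iff_continuousAt.2 fun t => (hasDerivAt_exp_smul_const A t).continuousAt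

theorem hasDerivAt_duhamel_homogeneous (A : E →L[ℝ] E) (x₀ : E) (t : ℝ) :
    HasDerivAt (duhamel A 0 x₀) (A (duhamel A 0 x₀ t)) t := by
  have hexp : duhamel A 0 x₀ = fun t => exp (t • A) x₀ := by
    ext t
    simp [duhamel]
  rw [hexp]
  simpa using (hasDerivAt_exp_smul_const' A t).clm_apply (hasDerivAt_const t x₀)

theorem exp_smul_exp_neg_smul_apply (A : E →L[ℝ] E) (s t : ℝ) (x : E) :
    exp (t • A) (exp (-s • A) x) = exp ((t - s) • A) x := by
  rw [sub_eq_add_neg, add_smul,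
    exp_add_of_commute_clm (((Commute.refl A).smul_left t).smul_right (-s)), mul_apply_eq_comp]

theorem continuousOn_exp_neg_smul_apply (A : E →L[ℝ] E) (hh : ContinuousOn h (Icc 0 T)) :
    ContinuousOn (fun s => exp (-s • A) (h s)) (Icc 0 T) :=
  ((continuous_exp_smul A).comp continuous_neg).continuousOn.clm_apply hh

theorem intervalIntegrable_exp_neg_smul_apply (A : E →L[ℝ] E) (hh : ContinuousOn h (Icc 0 T))
    (ht : t ∈ Icc 0 T) :
    IntervalIntegrable (fun s => exp (-s • A) (h s)) volume 0 t :=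
  ((continuousOn_exp_neg_smul_apply A hh).mono
    (Icc_subset_Icc_right ht.2)).intervalIntegrable_of_Icc ht.1

theorem hasDerivWithinAt_duhamel (x₀ : E) (hh : ContinuousOn h (Icc 0 T)) (ht : t ∈ Icc 0 T) :
    HasDerivWithinAt (duhamel A h x₀) (A (duhamel A h x₀ t) + h t) (Icc 0 T) t := by
  have hcont := continuousOn_exp_neg_smul_apply A hh
  have : Fact (t ∈ Icc 0 T) := ⟨ht⟩
  have hint := intervalIntegral.integral_hasDerivWithinAt_right (s := Icc 0 T) (t := Icc 0 T)
    (intervalIntegrable_exp_neg_smul_apply A hh ht)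
    (hcont.stronglyMeasurableAtFilter_nhdsWithin measurableSet_Icc t) (hcont t ht)
  have hexp := (hasDerivAt_exp_smul_const' A t).hasDerivWithinAt (s := Icc 0 T)
  refine (hexp.clm_apply (hint.const_add x₀)).congr_deriv ?_
  rw [exp_smul_exp_neg_smul_apply, sub_self, zero_smul, exp_zero]
  rfl

theorem eq_duhamel_of_hasDerivWithinAt {x : ℝ → E}
    (hx : ∀ s ∈ Icc 0 T, HasDerivWithinAt x (A (x s) + h s) (Icc 0 T) s)
    (hh : ContinuousOn h (Icc 0 T)) (ht : t ∈ Icc 0 T) : x t = duhamel A h (x 0) t := by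
  have hsub : Icc 0 t ⊆ Icc 0 T := Icc_subset_Icc_right ht.2
  have hderiv : ∀ s ∈ Icc 0 t,
      HasDerivWithinAt (fun s => exp (-s • A) (x s)) (exp (-s • A) (h s)) (Icc 0 t) s := by
    intro s hs
    have hexp : HasDerivAt (fun s : ℝ => exp (-s • A)) (-(exp (-s • A) * A)) s := by
      simpa [Function.comp_def] using
        (hasDerivAt_exp_smul_const A (-s)).scomp s (hasDerivAt_neg s)
    refine (hexp.hasDerivWithinAt.clm_apply ((hx s (hsub hs)).mono hsub)).congr_deriv ?_
    rw [neg_apply, mul_apply_eq_comp, map_add, neg_add_cancel_left]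
  have hftc : ∫ s in (0 : ℝ)..t, exp (-s • A) (h s) = exp (-t • A) (x t) - x 0 := by
    simpa using intervalIntegral.integral_eq_sub_of_hasDerivAt_of_le ht.1
      (fun s hs => (hderiv s hs).continuousWithinAt)
      (fun s hs => (hderiv s (Ioo_subset_Icc_self hs)).hasDerivAt (Icc_mem_nhds hs.1 hs.2))
      (intervalIntegrable_exp_neg_smul_apply A hh ht)
  rw [duhamel, hftc, add_sub_cancel, exp_smul_exp_neg_smul_apply, sub_self, zero_smul, exp_zero,
    one_apply_eq_self]

theorem duhamel_eq_add_integral (A : E →L[ℝ] E) (x₀ : E) (hh : ContinuousOn h (Icc 0 T))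
    (ht : t ∈ Icc 0 T) :
    duhamel A h x₀ t = exp (t • A) x₀ + ∫ s in (0 : ℝ)..t, exp ((t - s) • A) (h s) := by
  rw [duhamel, map_add, ← ContinuousLinearMap.intervalIntegral_comp_comm _
    (intervalIntegrable_exp_neg_smul_apply A hh ht)]
  simp only [exp_smul_exp_neg_smul_apply]

theorem exp_smul_eq_smul_exp_smul_add (A : E →L[ℝ] E) (M t : ℝ) :
    exp (t • A) = Real.exp (-(t * M)) • exp (t • (A + M • 1)) := by
  have hsplit : t • A = t • (A + M • 1) + (-(t * M)) • (1 : E →L[ℝ] E) := by module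
  have hscalar : exp ((-(t * M)) • (1 : E →L[ℝ] E)) =
      Real.exp (-(t * M)) • (1 : E →L[ℝ] E) := by
    rw [← Algebra.algebraMap_eq_smul_one, ← algebraMap_exp_comm, Algebra.algebraMap_eq_smul_one,
      Real.exp_eq_exp_ℝ]
  rw [hsplit, exp_add_of_commute_clm ((Commute.one_right _).smul_right _), hscalar,
    mul_smul_comm, mul_one]

variable [PartialOrder E] [IsOrderedAddMonoid E] [IsOrderedModule ℝ E] [OrderClosedTopology E]

theorem monotone_exp (hA : Monotone ⇑A) : Monotone ⇑(exp A) := by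
  intro x y hxy
  have hseries (z : E) : HasSum (fun n : ℕ => (n.factorial : ℝ)⁻¹ • A^[n] z) (exp A z) := by
    simpa using (exp_series_hasSum_exp' (𝕂 := ℝ) A).mapL (ContinuousLinearMap.apply ℝ E z)
  exact hasSum_mono (hseries x) (hseries y) fun n =>
    smul_le_smul_of_nonneg_left (hA.iterate n hxy) (by positivity)

theorem monotone_exp_smul {M : ℝ} (hA : Monotone ⇑(A + M • (1 : E →L[ℝ] E))) (ht : 0 ≤ t) :
    Monotone ⇑(exp (t • A)) := by
  have hexp : Monotone ⇑(exp (t • (A + M • 1))) :=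
    monotone_exp fun _ _ hxy => smul_le_smul_of_nonneg_left (hA hxy) ht
  rw [exp_smul_eq_smul_exp_smul_add A M]
  exact fun _ _ hxy => smul_le_smul_of_nonneg_left (hexp hxy) (Real.exp_pos _).le

theorem duhamel_nonneg {M : ℝ} (hA : Monotone ⇑(A + M • (1 : E →L[ℝ] E))) (hx₀ : 0 ≤ x₀)
    (hh : ContinuousOn h (Icc 0 T)) (hh₀ : ∀ s ∈ Icc 0 T, 0 ≤ h s) (ht : t ∈ Icc 0 T) :
    0 ≤ duhamel A h x₀ t := by
  have hexp {s : ℝ} (hs : 0 ≤ s) {x : E} (hx : 0 ≤ x) : 0 ≤ exp (s • A) x :=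
    (monotone_iff_map_nonneg _).1 (monotone_exp_smul hA hs) x hx
  rw [duhamel_eq_add_integral A x₀ hh ht, intervalIntegral.integral_of_le ht.1]
  refine add_nonneg (hexp ht.1 hx₀) (integral_nonneg_of_ae ?_)
  filter_upwards [ae_restrict_mem measurableSet_Ioc] with s hs
  exact hexp (sub_nonneg.2 hs.2) (hh₀ s ⟨hs.1.le, hs.2.trans ht.2⟩)

end LinearODE

/-! ### Integral operators on `C[0,1]` -/

section OrderAndMeasure

open Set

instance orderClosedTopology_continuousMap {X α : Type*} [TopologicalSpace X] [TopologicalSpace α]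
    [PartialOrder α] [OrderClosedTopology α] : OrderClosedTopology C(X, α) where
  isClosed_le' := by
    simp only [ContinuousMap.le_def, ofPred_forall]
    exact isClosed_iInter fun x => isClosed_le (by fun_prop) (by fun_prop)

theorem continuousMap_sq_nonneg {X : Type*} [TopologicalSpace X] (f : C(X, ℝ)) : 0 ≤ f ^ 2 :=
  fun x => sq_nonneg (f x)

theorem isOpenPosMeasure_comap_subtype_val {X : Type*} [TopologicalSpace X] [MeasurableSpace X]
    {μ : Measure X} [μ.IsOpenPosMeasure] {s : Set X} (hs : MeasurableSet s)
    (hsub : s ⊆ closure (interior s)) :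
    (μ.comap (Subtype.val : s → X)).IsOpenPosMeasure where
  open_pos := by
    rintro _ ⟨V, hV, rfl⟩ ⟨x, hx⟩ hzero
    obtain ⟨y, hyV, hys⟩ := mem_closure_iff.1 (hsub x.2) V hV hx
    rw [comap_subtype_coe_apply hs, Subtype.image_preimage_coe, inter_comm] at hzero
    exact (hV.inter isOpen_interior).measure_ne_zero μ ⟨y, hyV, hys⟩
      (measure_mono_null (inter_subset_inter_right V interior_subset) hzero)

end OrderAndMeasure

noncomputable section

namespace UrnSystem

/-- Integration over `[0,1]`. -/
def integ : StrongDual ℝ C(I, ℝ) := densityFunctional 1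

/-- The pullback `f ↦ ((u, v) ↦ f u)` of a function of the first urn. -/
def pullFst : C(I, ℝ) →ₐ[ℝ] C(I × I, ℝ) := ContinuousMap.compRightAlgHom ℝ ℝ ContinuousMap.fst

/-- The pullback `f ↦ ((u, v) ↦ f v)` of a function of the second urn. -/
def pullSnd : C(I, ℝ) →ₐ[ℝ] C(I × I, ℝ) := ContinuousMap.compRightAlgHom ℝ ℝ ContinuousMap.snd

@[simp] theorem pullFst_apply (f : C(I, ℝ)) (p : I × I) : pullFst f p = f p.1 := rfl

@[simp] theorem pullSnd_apply (f : C(I, ℝ)) (p : I × I) : pullSnd f p = f p.2 := rfl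

@[simp] theorem integ_apply (f : C(I, ℝ)) : integ f = ∫ u : I, f u := by simp [integ]

theorem integ_nonneg {f : C(I, ℝ)} (hf : 0 ≤ f) : 0 ≤ integ f := by
  rw [integ_apply]
  exact integral_nonneg hf

theorem rowIntegral_nonneg {k : C(I × I, ℝ)} (hk : 0 ≤ k) : 0 ≤ rowIntegral k := by
  refine ContinuousMap.le_def.2 fun u => ?_
  rw [rowIntegral_apply]
  exact integral_nonneg fun v => hk (u, v)

theorem rowIntegral_add (k k' : C(I × I, ℝ)) :
    rowIntegral (k + k') = rowIntegral k + rowIntegral k' := by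
  ext u
  simp only [rowIntegral_apply, ContinuousMap.add_apply]
  exact integral_add (integrable_of_continuous (by fun_prop))
    (integrable_of_continuous (by fun_prop))

theorem rowIntegral_mul_pullFst (k : C(I × I, ℝ)) (f : C(I, ℝ)) :
    rowIntegral (k * pullFst f) = rowIntegral k * f := by
  ext u
  simp only [rowIntegral_apply, ContinuousMap.mul_apply, pullFst_apply, integral_mul_const]

theorem kernelOp_eq_rowIntegral (k : C(I × I, ℝ)) (f : C(I, ℝ)) :
    kernelOp k f = rowIntegral (k * pullSnd f) := by
  ext u
  simp

theorem mulOp_eq_mul (m f : C(I, ℝ)) : mulOp m f = m * f := rfl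

theorem transpose_transpose (k : C(I × I, ℝ)) : transpose (transpose k) = k := rfl

theorem transpose_add (k k' : C(I × I, ℝ)) :
    transpose (k + k') = transpose k + transpose k' := rfl

theorem transpose_mul (k k' : C(I × I, ℝ)) :
    transpose (k * k') = transpose k * transpose k' := rfl

theorem transpose_pullFst (f : C(I, ℝ)) : transpose (pullFst f) = pullSnd f := rfl

theorem transpose_pullSnd (f : C(I, ℝ)) : transpose (pullSnd f) = pullFst f := rfl

theorem integ_rowIntegral_transpose (k : C(I × I, ℝ)) :
    integ (rowIntegral (transpose k)) = integ (rowIntegral k) := by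
  simp only [integ_apply, rowIntegral_apply, transpose_apply]
  refine integral_integral_swap (f := fun u v => k (v, u)) ?_
  have hcont : Continuous (Function.uncurry fun u v : I => k (v, u)) := by
    simp only [Function.uncurry_def]
    fun_prop
  exact integrableOn_univ.mp (hcont.continuousOn.integrableOn_compact isCompact_univ)

theorem monotone_mulOp {m : C(I, ℝ)} (hm : 0 ≤ m) : Monotone ⇑(mulOp m) := fun _ _ hfg =>
  mul_le_mul_of_nonneg_left hfg hm

theorem monotone_kernelOp {k : C(I × I, ℝ)} (hk : 0 ≤ k) : Monotone ⇑(kernelOp k) := by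
  refine (monotone_iff_map_nonneg _).2 fun f hf => ?_
  rw [kernelOp_eq_rowIntegral]
  exact rowIntegral_nonneg (mul_nonneg hk fun p => hf p.2)

theorem exists_monotone_mulOp_add_add_smul_one (m : C(I, ℝ)) {B : C(I, ℝ) →L[ℝ] C(I, ℝ)}
    (hB : Monotone ⇑B) :
    ∃ M : ℝ, Monotone ⇑(mulOp m + B + M • (1 : C(I, ℝ) →L[ℝ] C(I, ℝ))) := by
  have hm : 0 ≤ m + ‖m‖ • (1 : C(I, ℝ)) := by
    refine ContinuousMap.le_def.2 fun u => ?_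
    have hu := m.neg_norm_le_apply u
    simp only [ContinuousMap.zero_apply, ContinuousMap.add_apply, ContinuousMap.smul_apply,
      ContinuousMap.one_apply, smul_eq_mul, mul_one]
    linarith
  have hsplit : mulOp m + B + ‖m‖ • (1 : C(I, ℝ) →L[ℝ] C(I, ℝ))
      = mulOp (m + ‖m‖ • (1 : C(I, ℝ))) + B := by
    ext f u
    simp
    ring
  exact ⟨‖m‖, hsplit ▸ (monotone_mulOp hm).add hB⟩

/-- The total effect on the urn `u` of interactions having the effect `p` on their first urn and
`q` on their second urn: it is `∫ p (u, v) dv + ∫ q (v, u) dv`. -/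
def siteIntegral (p q : C(I × I, ℝ)) : C(I, ℝ) := rowIntegral p + rowIntegral (transpose q)

theorem siteIntegral_add (p q p' q' : C(I × I, ℝ)) :
    siteIntegral (p + p') (q + q') = siteIntegral p q + siteIntegral p' q' := by
  simp only [siteIntegral, transpose_add, rowIntegral_add]
  abel

theorem mul_siteIntegral (f : C(I, ℝ)) (p q : C(I × I, ℝ)) :
    f * siteIntegral p q = siteIntegral (p * pullFst f) (q * pullSnd f) := by
  rw [siteIntegral, siteIntegral, transpose_mul, transpose_pullSnd, rowIntegral_mul_pullFst,
    rowIntegral_mul_pullFst]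
  ring

theorem siteIntegral_nonneg {p q : C(I × I, ℝ)} (hp : 0 ≤ p) (hq : 0 ≤ q) :
    0 ≤ siteIntegral p q :=
  add_nonneg (rowIntegral_nonneg hp) (rowIntegral_nonneg fun z => hq z.swap)

theorem integ_siteIntegral (p q : C(I × I, ℝ)) :
    integ (siteIntegral p q) = integ (rowIntegral (p + q)) := by
  rw [siteIntegral, map_add, integ_rowIntegral_transpose, rowIntegral_add, map_add]

theorem densityFunctional_eq_integ (g f : C(I, ℝ)) : densityFunctional g f = integ (g * f) := by
  simp

theorem densityFunctional_mulOp (m g f : C(I, ℝ)) :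
    densityFunctional (mulOp m g) f = densityFunctional g (mulOp m f) := by
  simp only [densityFunctional_eq_integ, mulOp_eq_mul, mul_left_comm, mul_assoc]

theorem densityFunctional_kernelOp (k : C(I × I, ℝ)) (g f : C(I, ℝ)) :
    densityFunctional (kernelOp k g) f = densityFunctional g (kernelOp (transpose k) f) := by
  rw [densityFunctional_eq_integ, densityFunctional_eq_integ, kernelOp_eq_rowIntegral,
    kernelOp_eq_rowIntegral, ← rowIntegral_mul_pullFst, mul_comm g, ← rowIntegral_mul_pullFst,
    ← integ_rowIntegral_transpose]
  simp only [transpose_mul, transpose_pullFst, transpose_pullSnd, mul_right_comm]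

/-- The embedding `g ↦ g(u) du` of `C[0,1]` into its dual, as a bounded operator. -/
def densityCLM : C(I, ℝ) →L[ℝ] StrongDual ℝ C(I, ℝ) :=
  (ContinuousLinearMap.compL ℝ C(I, ℝ) C(I, ℝ) ℝ integ).comp (ContinuousLinearMap.mul ℝ C(I, ℝ))

theorem densityCLM_apply (g : C(I, ℝ)) : densityCLM g = densityFunctional g := by
  ext f
  exact (densityFunctional_eq_integ g f).symm

theorem densityCLM_injective : Function.Injective densityCLM := by
  refine (injective_iff_map_eq_zero _).2 fun g hg => ?_
  have hsub : Set.Icc (0 : ℝ) 1 ⊆ closure (interior (Set.Icc 0 1)) := by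
    rw [interior_Icc, closure_Ioo zero_ne_one]
  have : (volume : Measure I).IsOpenPosMeasure :=
    isOpenPosMeasure_comap_subtype_val measurableSet_Icc hsub
  have hint : ∫ u : I, g u * g u = 0 := by
    rw [← densityFunctional_apply, ← densityCLM_apply, hg, zero_apply]
  have hcont : Continuous fun u : I => g u * g u := by fun_prop
  have hae := (integral_eq_zero_iff_of_nonneg (fun u => mul_self_nonneg (g u))
    (integrable_of_continuous hcont)).1 hint
  ext u
  exact mul_self_eq_zero.1 (congrFun ((hcont.ae_eq_iff_eq volume continuous_zero).1 hae) u)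

/-! ### The first and second moment densities -/

/-- The mixed second moment `E[(A X_u + B X_v)(A' X_u + B' X_v)]` as a function of `(u, v)`, where
the occupation variables satisfy `E[X_u²] = w u` and `E[X_u X_v] = r u * r v` for distinct urns. -/
def mixedMoment (w r : C(I, ℝ)) (A B A' B' : C(I × I, ℝ)) : C(I × I, ℝ) :=
  A * A' * pullFst w + B * B' * pullSnd w + (A * B' + B * A') * (pullFst r * pullSnd r)

theorem mixedMoment_self_nonneg {w r : C(I, ℝ)} (hrw : r ^ 2 ≤ w) (A B : C(I × I, ℝ)) :
    0 ≤ mixedMoment w r A B A B := by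
  have hvar : mixedMoment w r A B A B = (A * pullFst r + B * pullSnd r) ^ 2
      + (A ^ 2 * pullFst (w - r ^ 2) + B ^ 2 * pullSnd (w - r ^ 2)) := by
    simp only [mixedMoment, map_sub, map_pow]
    ring
  have hdiff : 0 ≤ w - r ^ 2 := sub_nonneg.2 hrw
  rw [hvar]
  exact add_nonneg (continuousMap_sq_nonneg _) (add_nonneg
    (mul_nonneg (continuousMap_sq_nonneg A) fun p => hdiff p.1)
    (mul_nonneg (continuousMap_sq_nonneg B) fun p => hdiff p.2))

variable (S : UrnSystem)

/-- The predual of `P₂`, acting on densities. -/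
def predualP2 : C(I, ℝ) →L[ℝ] C(I, ℝ) :=
  mulOp ((S.c ^ 2 - 1) * S.b + rowIntegral (S.lam * (S.a1 ^ 2 - 1))
      + rowIntegral (transpose (S.lam * (S.a4 ^ 2 - 1))))
    + (kernelOp (S.lam * S.a2 ^ 2) + kernelOp (transpose (S.lam * S.a3 ^ 2)))

/-- The density of the source functional `l₁`. -/
def sourceDensity (r : C(I, ℝ)) : C(I, ℝ) :=
  (2 : ℝ) • (r * kernelOp (S.lam * S.a1 * S.a2) r)
    + (2 : ℝ) • (r * kernelOp (transpose (S.lam * S.a3 * S.a4)) r)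

/-- The function `K₁` for the second moment density `w` and the first moment density `r`. -/
def diagNoise (w r : C(I, ℝ)) : C(I, ℝ) :=
  w * S.b * (S.c - 1) ^ 2
    + siteIntegral (S.lam * mixedMoment w r (S.a1 - 1) S.a2 (S.a1 - 1) S.a2)
        (S.lam * mixedMoment w r S.a3 (S.a4 - 1) S.a3 (S.a4 - 1))

/-- The function `K₂` for the second moment density `w` and the first moment density `r`. -/
def crossNoise (w r : C(I, ℝ)) : C(I × I, ℝ) :=
  2 * S.lam * mixedMoment w r (S.a1 - 1) S.a2 S.a3 (S.a4 - 1)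

theorem densityCLM_predualP2 (g : C(I, ℝ)) :
    densityCLM (S.predualP2 g) = (densityCLM g).comp S.P2 := by
  ext f
  have hmul (m m' : C(I, ℝ)) : mulOp (m + m') g = mulOp m g + mulOp m' g := add_mul m m' g
  simp only [predualP2, P2, P3, P4, P5, P6, P7, add_apply, hmul, map_add,
    ContinuousLinearMap.comp_apply]
  simp only [densityCLM_apply, densityFunctional_mulOp, densityFunctional_kernelOp,
    transpose_transpose]
  ring

theorem densityCLM_sourceDensity (r : C(I, ℝ)) : densityCLM (S.sourceDensity r) = S.l1 r := by
  simp only [l1, sourceDensity, map_add, map_smul, densityCLM_apply]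

theorem continuous_sourceDensity : Continuous S.sourceDensity := by
  unfold sourceDensity
  fun_prop

theorem hydroOp_eq_siteIntegral (r : C(I, ℝ)) :
    S.hydroOp r = S.b * (S.c - 1) * r
      + siteIntegral (S.lam * ((S.a1 - 1) * pullFst r + S.a2 * pullSnd r))
          (S.lam * (S.a3 * pullFst r + (S.a4 - 1) * pullSnd r)) := by
  simp only [hydroOp, siteIntegral, mul_add, ← mul_assoc, rowIntegral_add, transpose_add,
    transpose_mul, transpose_pullFst, transpose_pullSnd, rowIntegral_mul_pullFst,
    ← kernelOp_eq_rowIntegral, add_apply, mulOp_eq_mul]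
  ring

theorem predualP2_eq_siteIntegral (w : C(I, ℝ)) :
    S.predualP2 w = (S.c ^ 2 - 1) * S.b * w
      + siteIntegral (S.lam * ((S.a1 ^ 2 - 1) * pullFst w + S.a2 ^ 2 * pullSnd w))
          (S.lam * (S.a3 ^ 2 * pullFst w + (S.a4 ^ 2 - 1) * pullSnd w)) := by
  simp only [predualP2, siteIntegral, mul_add, ← mul_assoc, rowIntegral_add, transpose_add,
    transpose_mul, transpose_pullFst, transpose_pullSnd, rowIntegral_mul_pullFst,
    ← kernelOp_eq_rowIntegral, add_apply, mulOp_eq_mul]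
  ring

theorem sourceDensity_eq_siteIntegral (r : C(I, ℝ)) :
    S.sourceDensity r = siteIntegral (2 * S.lam * S.a1 * S.a2 * pullFst r * pullSnd r)
      (2 * S.lam * S.a3 * S.a4 * pullFst r * pullSnd r) := by
  have hsite : siteIntegral (S.lam * S.a1 * S.a2 * pullSnd r) (S.lam * S.a3 * S.a4 * pullFst r)
      = kernelOp (S.lam * S.a1 * S.a2) r + kernelOp (transpose (S.lam * S.a3 * S.a4)) r := by
    simp only [siteIntegral, transpose_mul, transpose_pullFst, kernelOp_eq_rowIntegral]
  rw [sourceDensity, ← smul_add, ← mul_add, ← hsite, two_smul, ← add_mul, mul_siteIntegral,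
    map_add, map_add]
  congr 1 <;> ring

/-- The carré du champ identity: it makes `ρ ^ 2` a subsolution of the equation of the second moment
density. -/
theorem predualP2_sq_add_sourceDensity (r : C(I, ℝ)) :
    S.predualP2 (r ^ 2) + S.sourceDensity r = 2 * r * S.hydroOp r + S.diagNoise (r ^ 2) r := by
  rw [predualP2_eq_siteIntegral, sourceDensity_eq_siteIntegral, hydroOp_eq_siteIntegral, diagNoise,
    mul_add (2 * r), mul_siteIntegral, add_assoc, ← siteIntegral_add, add_add_add_comm,
    ← siteIntegral_add]
  simp only [mixedMoment, map_mul, map_pow, map_ofNat]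
  congr 2 <;> ring

variable {S}

theorem diagNoise_nonneg (hb : 0 ≤ S.b) (hlam : 0 ≤ S.lam) {w r : C(I, ℝ)} (hrw : r ^ 2 ≤ w) :
    0 ≤ S.diagNoise w r := by
  have hw : 0 ≤ w := (continuousMap_sq_nonneg r).trans hrw
  exact add_nonneg (mul_nonneg (mul_nonneg hw hb) (continuousMap_sq_nonneg _))
    (siteIntegral_nonneg (mul_nonneg hlam (mixedMoment_self_nonneg hrw _ _))
      (mul_nonneg hlam (mixedMoment_self_nonneg hrw _ _)))

theorem exists_monotone_predualP2_add_smul_one (hlam : 0 ≤ S.lam) :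
    ∃ M : ℝ, Monotone ⇑(S.predualP2 + M • (1 : C(I, ℝ) →L[ℝ] C(I, ℝ))) :=
  have hpos (a : C(I × I, ℝ)) : 0 ≤ S.lam * a ^ 2 :=
    mul_nonneg hlam (continuousMap_sq_nonneg a)
  exists_monotone_mulOp_add_add_smul_one _
    ((monotone_kernelOp (hpos S.a2)).add (monotone_kernelOp fun p => hpos S.a3 p.swap))

variable (S) in
/-- The solution of the equation of the second moment density, driven by the first moment
density `ρ`. -/
def secondMomentDensity (ρ : ℝ → C(I, ℝ)) : ℝ → C(I, ℝ) :=
  duhamel S.predualP2 (fun t => S.sourceDensity (ρ t)) S.phi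

variable {T t : ℝ} {ρ : ℝ → C(I, ℝ)} {θ : ℝ → StrongDual ℝ C(I, ℝ)}

variable (S) in
theorem isHydrodynamicDensity_duhamel : S.IsHydrodynamicDensity (duhamel S.hydroOp 0 S.phi) :=
  ⟨duhamel_zero _ _ _, fun t _ =>
    (hasDerivAt_duhamel_homogeneous S.hydroOp S.phi t).hasDerivWithinAt⟩

theorem IsHydrodynamicDensity.hasDerivWithinAt (hρ : S.IsHydrodynamicDensity ρ)
    (ht : t ∈ Set.Icc 0 T) : HasDerivWithinAt ρ (S.hydroOp (ρ t)) (Set.Icc 0 T) t :=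
  (hρ.2 t ht.1).mono Set.Icc_subset_Ici_self

theorem IsHydrodynamicDensity.continuousOn (hρ : S.IsHydrodynamicDensity ρ) :
    ContinuousOn ρ (Set.Icc 0 T) := fun _ ht =>
  (hρ.hasDerivWithinAt ht).continuousWithinAt

theorem hasDerivWithinAt_secondMomentDensity (hρ : ContinuousOn ρ (Set.Icc 0 T))
    (ht : t ∈ Set.Icc 0 T) :
    HasDerivWithinAt (S.secondMomentDensity ρ)
      (S.predualP2 (S.secondMomentDensity ρ t) + S.sourceDensity (ρ t)) (Set.Icc 0 T) t :=
  hasDerivWithinAt_duhamel S.phi (S.continuous_sourceDensity.comp_continuousOn hρ) ht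

theorem isSecondMomentSolution_secondMomentDensity (hρ : ContinuousOn ρ (Set.Icc 0 T)) :
    S.IsSecondMomentSolution T ρ fun t => densityCLM (S.secondMomentDensity ρ t) := by
  refine ⟨by simp only [secondMomentDensity, duhamel_zero, densityCLM_apply], fun t ht => ?_⟩
  rw [← densityCLM_predualP2, ← densityCLM_sourceDensity, ← map_add]
  exact hasDerivWithinAt_clm_comp (F := StrongDual ℝ C(I, ℝ)) densityCLM
    (hasDerivWithinAt_secondMomentDensity hρ ht)

theorem IsSecondMomentSolution.eq_densityCLM_secondMomentDensity
    (hθ : S.IsSecondMomentSolution T ρ θ) (hρ : ContinuousOn ρ (Set.Icc 0 T))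
    (ht : t ∈ Set.Icc 0 T) : θ t = densityCLM (S.secondMomentDensity ρ t) := by
  have hsource : ContinuousOn (fun s => S.l1 (ρ s)) (Set.Icc 0 T) := by
    simp only [← densityCLM_sourceDensity]
    exact (densityCLM.continuous.comp S.continuous_sourceDensity).comp_continuousOn hρ
  have hunique {θ' : ℝ → StrongDual ℝ C(I, ℝ)} (hθ' : S.IsSecondMomentSolution T ρ θ') :
      θ' t = duhamel ((ContinuousLinearMap.compL ℝ C(I, ℝ) C(I, ℝ) ℝ).flip S.P2)
        (fun s => S.l1 (ρ s)) (densityFunctional S.phi) t :=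
    hθ'.1 ▸ eq_duhamel_of_hasDerivWithinAt hθ'.2 hsource ht
  exact (hunique hθ).trans (hunique (isSecondMomentSolution_secondMomentDensity hρ)).symm

theorem sq_le_secondMomentDensity (hb : 0 ≤ S.b) (hlam : 0 ≤ S.lam)
    (hphi : S.phi ∈ Set.Icc 0 1) (hρ : S.IsHydrodynamicDensity ρ) (ht : t ∈ Set.Icc 0 T) :
    ρ t ^ 2 ≤ S.secondMomentDensity ρ t := by
  obtain ⟨M, hM⟩ := exists_monotone_predualP2_add_smul_one hlam
  have hnoise (r : C(I, ℝ)) : S.diagNoise (r ^ 2) r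
      = S.predualP2 (r ^ 2) + S.sourceDensity r - 2 * r * S.hydroOp r :=
    eq_sub_of_add_eq' (S.predualP2_sq_add_sourceDensity r).symm
  have hderiv : ∀ s ∈ Set.Icc 0 T, HasDerivWithinAt (fun s => S.secondMomentDensity ρ s - ρ s ^ 2)
      (S.predualP2 (S.secondMomentDensity ρ s - ρ s ^ 2) + S.diagNoise (ρ s ^ 2) (ρ s))
      (Set.Icc 0 T) s := by
    intro s hs
    refine ((hasDerivWithinAt_secondMomentDensity hρ.continuousOn hs).sub
      ((hρ.hasDerivWithinAt hs).pow 2)).congr_deriv ?_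
    rw [hnoise, map_sub]
    simp only [Nat.cast_ofNat, Nat.add_one_sub_one, pow_one]
    ring
  have hcont : ContinuousOn (fun s => S.diagNoise (ρ s ^ 2) (ρ s)) (Set.Icc 0 T) := by
    have hsource := S.continuous_sourceDensity
    have hnoise_cont : Continuous fun r : C(I, ℝ) => S.diagNoise (r ^ 2) r := by
      simp only [hnoise]
      fun_prop
    exact hnoise_cont.comp_continuousOn hρ.continuousOn
  have hinit : 0 ≤ S.secondMomentDensity ρ 0 - ρ 0 ^ 2 := by
    rw [secondMomentDensity, duhamel_zero, hρ.1, sub_nonneg]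
    exact pow_le_of_le_one hphi.1 hphi.2 two_ne_zero
  rw [← sub_nonneg]
  exact (duhamel_nonneg hM hinit hcont (fun s _ => diagNoise_nonneg hb hlam le_rfl) ht).trans_eq
    (eq_duhamel_of_hasDerivWithinAt hderiv hcont ht).symm

/-- The time slice `ϑ(s, ·)`. -/
def slice (ϑ : C(Set.Icc (0 : ℝ) T × I, ℝ)) (s : Set.Icc (0 : ℝ) T) : C(I, ℝ) := ϑ.curry s

@[simp] theorem slice_apply (ϑ : C(Set.Icc (0 : ℝ) T × I, ℝ)) (s : Set.Icc (0 : ℝ) T) (u : I) :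
    slice ϑ s u = ϑ (s, u) := rfl

theorem exists_isDensityOf {g : ℝ → C(I, ℝ)} (hg : ContinuousOn g (Set.Icc 0 T)) :
    ∃ ϑ : C(Set.Icc (0 : ℝ) T × I, ℝ), IsDensityOf ϑ fun t => densityCLM (g t) :=
  ⟨ContinuousMap.uncurry ⟨_, hg.domRestrict⟩, fun t f => by
    simp only [densityCLM_apply, densityFunctional_apply]
    rfl⟩

variable (S T) in
theorem exists_hydrodynamicDensity_secondMomentSolution_density :
    ∃ (ρ : ℝ → C(I, ℝ)) (θ : ℝ → StrongDual ℝ C(I, ℝ)) (ϑ : C(Set.Icc (0 : ℝ) T × I, ℝ)),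
      S.IsHydrodynamicDensity ρ ∧ S.IsSecondMomentSolution T ρ θ ∧ IsDensityOf ϑ θ := by
  have hρ := S.isHydrodynamicDensity_duhamel
  obtain ⟨ϑ, hϑ⟩ := exists_isDensityOf (T := T) fun t ht =>
    (hasDerivWithinAt_secondMomentDensity hρ.continuousOn ht).continuousWithinAt
  exact ⟨_, _, ϑ, hρ, isSecondMomentSolution_secondMomentDensity hρ.continuousOn, hϑ⟩

variable {ϑ : C(Set.Icc (0 : ℝ) T × I, ℝ)} {s : Set.Icc (0 : ℝ) T}

theorem IsDensityOf.densityCLM_slice (hϑ : IsDensityOf ϑ θ) (s : Set.Icc (0 : ℝ) T) :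
    densityCLM (slice ϑ s) = θ s := by
  ext f
  rw [densityCLM_apply, hϑ s f]
  rfl

theorem sq_le_slice (hb : 0 ≤ S.b) (hlam : 0 ≤ S.lam) (hphi : S.phi ∈ Set.Icc 0 1)
    (hρ : S.IsHydrodynamicDensity ρ) (hθ : S.IsSecondMomentSolution T ρ θ)
    (hϑ : IsDensityOf ϑ θ) (s : Set.Icc (0 : ℝ) T) : ρ s ^ 2 ≤ slice ϑ s := by
  have hslice : slice ϑ s = S.secondMomentDensity ρ s := densityCLM_injective <|
    (hϑ.densityCLM_slice s).trans (hθ.eq_densityCLM_secondMomentDensity hρ.continuousOn s.2)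
  exact hslice ▸ sq_le_secondMomentDensity hb hlam hphi hρ s.2

/-! ### The bilinear form -/

/-- The bilinear form `f, g ↦ ∫ k f g + ∬ q(u,v) f(v) g(u) du dv`. It need not be symmetric. -/
def noiseForm (k : C(I, ℝ)) (q : C(I × I, ℝ)) : C(I, ℝ) →L[ℝ] StrongDual ℝ C(I, ℝ) :=
  densityCLM.comp (mulOp k + kernelOp q)

theorem noiseForm_self (k : C(I, ℝ)) (q : C(I × I, ℝ)) (f : C(I, ℝ)) :
    noiseForm k q f f = integ (k * f ^ 2)
      + integ (rowIntegral (q * (pullFst f * pullSnd f))) := by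
  rw [noiseForm, ContinuousLinearMap.comp_apply, densityCLM_apply, densityFunctional_eq_integ,
    add_apply, add_mul, map_add, mulOp_eq_mul, kernelOp_eq_rowIntegral, ← rowIntegral_mul_pullFst,
    mul_assoc, ← sq, mul_assoc, mul_comm (pullSnd f)]

variable (S) in
theorem noiseForm_diagNoise_crossNoise (w r f : C(I, ℝ)) :
    noiseForm (S.diagNoise w r) (S.crossNoise w r) f f =
      integ (w * S.b * ((S.c - 1) * f) ^ 2)
        + integ (rowIntegral (S.lam * mixedMoment w r
            ((S.a1 - 1) * pullFst f + S.a3 * pullSnd f) (S.a2 * pullFst f + (S.a4 - 1) * pullSnd f)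
            ((S.a1 - 1) * pullFst f + S.a3 * pullSnd f)
            (S.a2 * pullFst f + (S.a4 - 1) * pullSnd f))) := by
  rw [noiseForm_self, diagNoise, mul_comm _ (f ^ 2), mul_add, map_add, mul_siteIntegral,
    integ_siteIntegral, add_assoc, ← map_add, ← rowIntegral_add]
  congr 2
  · ring
  · simp only [crossNoise, mixedMoment, map_pow]
    congr 1
    ring

theorem noiseForm_diagNoise_crossNoise_nonneg (hb : 0 ≤ S.b) (hlam : 0 ≤ S.lam) {w r : C(I, ℝ)}
    (hrw : r ^ 2 ≤ w) (f : C(I, ℝ)) :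
    0 ≤ noiseForm (S.diagNoise w r) (S.crossNoise w r) f f := by
  have hw : 0 ≤ w := (continuousMap_sq_nonneg r).trans hrw
  rw [noiseForm_diagNoise_crossNoise]
  exact add_nonneg (integ_nonneg (mul_nonneg (mul_nonneg hw hb) (continuousMap_sq_nonneg _)))
    (integ_nonneg (rowIntegral_nonneg (mul_nonneg hlam (mixedMoment_self_nonneg hrw _ _))))

variable (S ρ ϑ s)

theorem diagNoise_eq_rowIntegral (w r : C(I, ℝ)) :
    S.diagNoise w r = w * S.b * (S.c - 1) ^ 2
      + w * rowIntegral (S.lam * (S.a1 - 1) ^ 2)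
      + rowIntegral (pullSnd w * S.lam * S.a2 ^ 2)
      + rowIntegral (transpose (S.lam * S.a3 ^ 2) * pullSnd w)
      + rowIntegral (transpose (S.lam * (S.a4 - 1) ^ 2)) * w
      + 2 * rowIntegral (S.lam * (S.a1 - 1) * S.a2 * pullSnd r) * r
      + 2 * rowIntegral (transpose (S.lam * S.a3 * (S.a4 - 1)) * pullSnd r) * r := by
  have hfst : S.lam * mixedMoment w r (S.a1 - 1) S.a2 (S.a1 - 1) S.a2 =
      S.lam * (S.a1 - 1) ^ 2 * pullFst w + pullSnd w * S.lam * S.a2 ^ 2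
        + (S.lam * (S.a1 - 1) * S.a2 * pullSnd r + S.lam * (S.a1 - 1) * S.a2 * pullSnd r)
          * pullFst r := by
    rw [mixedMoment]
    ring
  have hsnd : S.lam * mixedMoment w r S.a3 (S.a4 - 1) S.a3 (S.a4 - 1) =
      S.lam * S.a3 ^ 2 * pullFst w + S.lam * (S.a4 - 1) ^ 2 * pullSnd w
        + (S.lam * S.a3 * (S.a4 - 1) * pullFst r + S.lam * S.a3 * (S.a4 - 1) * pullFst r)
          * pullSnd r := by
    rw [mixedMoment]
    ring
  rw [diagNoise, hfst, hsnd]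
  simp only [siteIntegral, transpose_add, transpose_mul _ (pullFst _), transpose_mul _ (pullSnd _),
    transpose_pullFst, transpose_pullSnd, rowIntegral_add, rowIntegral_mul_pullFst]
  ring

theorem K1_eq_diagNoise (u : I) : S.K1 ρ ϑ s u = S.diagNoise (slice ϑ s) (ρ s) u := by
  have htwo : (2 : C(I, ℝ)) u = 2 := rfl
  simp [diagNoise_eq_rowIntegral, K1, htwo]

theorem K2_eq_crossNoise (u v : I) :
    S.K2 ρ ϑ s u v = S.crossNoise (slice ϑ s) (ρ s) (u, v) := by
  change _ = 2 * S.lam (u, v) * ((S.a1 (u, v) - 1) * S.a3 (u, v) * ϑ (s, u)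
    + S.a2 (u, v) * (S.a4 (u, v) - 1) * ϑ (s, v)
    + ((S.a1 (u, v) - 1) * (S.a4 (u, v) - 1) + S.a2 (u, v) * S.a3 (u, v)) * (ρ s u * ρ s v))
  rw [K2]
  ring

theorem quadForm_eq_noiseForm (f : C(I, ℝ)) :
    S.quadForm ρ ϑ s f =
      noiseForm (S.diagNoise (slice ϑ s) (ρ s)) (S.crossNoise (slice ϑ s) (ρ s)) f f := by
  simp [noiseForm_self, quadForm, K1_eq_diagNoise, K2_eq_crossNoise, mul_assoc]

theorem bracket_eq_symm_noiseForm (f g : C(I, ℝ)) :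
    S.bracket ρ ϑ s f g =
      (noiseForm (S.diagNoise (slice ϑ s) (ρ s)) (S.crossNoise (slice ϑ s) (ρ s)) f g
        + noiseForm (S.diagNoise (slice ϑ s) (ρ s)) (S.crossNoise (slice ϑ s) (ρ s)) g f) / 2 := by
  simp only [bracket, quadForm_eq_noiseForm, map_add, map_sub, add_apply, sub_apply]
  ring

theorem bracket_self (f : C(I, ℝ)) : S.bracket ρ ϑ s f f = S.quadForm ρ ϑ s f := by
  rw [bracket_eq_symm_noiseForm, quadForm_eq_noiseForm, add_self_div_two]

theorem bracket_comm (f g : C(I, ℝ)) : S.bracket ρ ϑ s f g = S.bracket ρ ϑ s g f := by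
  rw [bracket_eq_symm_noiseForm, bracket_eq_symm_noiseForm, add_comm]

theorem bracket_add_smul_left (f₁ f₂ g : C(I, ℝ)) (c₁ c₂ : ℝ) :
    S.bracket ρ ϑ s (c₁ • f₁ + c₂ • f₂) g =
      c₁ * S.bracket ρ ϑ s f₁ g + c₂ * S.bracket ρ ϑ s f₂ g := by
  simp only [bracket_eq_symm_noiseForm, map_add, map_smul, add_apply, smul_apply, smul_eq_mul]
  ring

end UrnSystem

end

theorem lemma2p5_general (S : UrnSystem) (hb : 0 ≤ S.b) (hlam : 0 ≤ S.lam)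
    (hphi : S.phi ∈ Set.Icc 0 1) (T : ℝ) :
    (∃ (ρ : ℝ → C(I, ℝ)) (θ : ℝ → StrongDual ℝ C(I, ℝ))
        (ϑ : C(Set.Icc (0 : ℝ) T × I, ℝ)),
      S.IsHydrodynamicDensity ρ ∧ S.IsSecondMomentSolution T ρ θ ∧
        UrnSystem.IsDensityOf ϑ θ) ∧
    ∀ (ρ : ℝ → C(I, ℝ)) (θ : ℝ → StrongDual ℝ C(I, ℝ))
        (ϑ : C(Set.Icc (0 : ℝ) T × I, ℝ)),
      S.IsHydrodynamicDensity ρ → S.IsSecondMomentSolution T ρ θ →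
      UrnSystem.IsDensityOf ϑ θ →
      ∀ s : Set.Icc (0 : ℝ) T,
        (∀ f : C(I, ℝ),
          S.bracket ρ ϑ s f f = S.quadForm ρ ϑ s f ∧ 0 ≤ S.bracket ρ ϑ s f f) ∧
        (∀ f₁ f₂ : C(I, ℝ), S.bracket ρ ϑ s f₁ f₂ = S.bracket ρ ϑ s f₂ f₁) ∧
        (∀ (f₁ f₂ g : C(I, ℝ)) (c₁ c₂ : ℝ),
          S.bracket ρ ϑ s (c₁ • f₁ + c₂ • f₂) g =
            c₁ * S.bracket ρ ϑ s f₁ g + c₂ * S.bracket ρ ϑ s f₂ g) := by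
  refine ⟨S.exists_hydrodynamicDensity_secondMomentSolution_density T, fun ρ θ ϑ hρ hθ hϑ s =>
    ⟨fun f => ⟨S.bracket_self ρ ϑ s f, ?_⟩, S.bracket_comm ρ ϑ s, S.bracket_add_smul_left ρ ϑ s⟩⟩
  have hsq : ρ s ^ 2 ≤ UrnSystem.slice ϑ s := UrnSystem.sq_le_slice hb hlam hphi hρ hθ hϑ s
  rw [S.bracket_self, S.quadForm_eq_noiseForm]
  exact UrnSystem.noiseForm_diagNoise_crossNoise_nonneg hb hlam hsq f

theorem lemma2p5 (S : UrnSystem) (hS : S.Admissible) (T : ℝ) (hT : 0 < T) :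
    -- the objects entering the form exist
    (∃ (ρ : ℝ → C(unitInterval, ℝ)) (θ : ℝ → StrongDual ℝ C(unitInterval, ℝ))
        (ϑ : C(Set.Icc (0 : ℝ) T × unitInterval, ℝ)),
      S.IsHydrodynamicDensity ρ ∧ S.IsSecondMomentSolution T ρ θ ∧
        UrnSystem.IsDensityOf ϑ θ) ∧
    -- and the form built from them is a non-negative definite symmetric bilinear form
    ∀ (ρ : ℝ → C(unitInterval, ℝ)) (θ : ℝ → StrongDual ℝ C(unitInterval, ℝ))
        (ϑ : C(Set.Icc (0 : ℝ) T × unitInterval, ℝ)),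
      S.IsHydrodynamicDensity ρ → S.IsSecondMomentSolution T ρ θ →
      UrnSystem.IsDensityOf ϑ θ →
      ∀ s : Set.Icc (0 : ℝ) T,
        (∀ f : C(unitInterval, ℝ),
          S.bracket ρ ϑ s f f = S.quadForm ρ ϑ s f ∧ 0 ≤ S.bracket ρ ϑ s f f) ∧
        (∀ f₁ f₂ : C(unitInterval, ℝ), S.bracket ρ ϑ s f₁ f₂ = S.bracket ρ ϑ s f₂ f₁) ∧
        (∀ (f₁ f₂ g : C(unitInterval, ℝ)) (c₁ c₂ : ℝ),
          S.bracket ρ ϑ s (c₁ • f₁ + c₂ • f₂) g =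
            c₁ * S.bracket ρ ϑ s f₁ g + c₂ * S.bracket ρ ϑ s f₂ g) := by
  exact lemma2p5_general S hS.b_nonneg hS.lam_nonneg
    ⟨fun u => (hS.phi_mem u).1, fun u => (hS.phi_mem u).2⟩ T
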